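/- \textbf{Setting.} A system has components $\mathcal U=\{1,\dots,M\}$, $M\ge 1$. The hypothesis $X\in\{0,1,\dots,M\}$ has prior $\rho_1$ with $\rho_1(j)>0$ for every $j\in\mathcal U$; $X=0$ means that there is no anomaly and $X=j\ge 1$ that component $j$ is anomalous. Put $\tilde\rho_1(j)=\rho_1(j)/(1-\rho_1(0))$ for $j\in\mathcal U$. At each time $n=1,\dots,N$ an agent draws a component $U_n\sim g_n(U_{1:n-1},Y_{1:n-1})$ and observes $Y_n$, which given $U_n=u$, $X=x$ and the past has density $p_1^u$ if $x=u$ and $p_0^u$ if $x\ne u$, with respect to a $\sigma$-finite measure $\nu$ on a measurable space $\mathcal Y$. After $N$ experiments it draws a verdict $\hat X_N$ (safe or not safe) from a distribution $f(U_{1:N},Y_{1:N})$. For $\epsilon\in(0,1)$ let $\phi_N^*=\phi_N^*(\epsilon)$ be the infimum over all strategy pairs $(f,g)$ of $\mathbb P^{f,g}[\hat X_N=\text{safe}\mid X\neq 0]$ subject to $\mathbb P^{f,g}[\hat X_N=\text{safe}\mid X=0]\ge 1-\epsilon$. Let $\lambda_j(u,y)=\log\frac{p_0^u(y)}{p_1^u(y)}$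 if $u=j$ and $\lambda_j(u,y)=0$ otherwise, and $D_j^u=\int\lambda_j(u,y)\,p_0^u(y)\,d\nu(y)$. Assume that $\int\bigl(\log\frac{p_0^u}{p_1^u}\bigr)^2p_k^u\,d\nu<\infty$ for all $u\in\mathcal U$ and $k\in\{0,1\}$, and that $D_u^u>0$ for all $u\in\mathcal U$. Let $\beta^*$ attain $\min_{\beta}\max_{u}\sum_{j}\beta(j)D_j^u$ over probability distributions $\beta$ on $\mathcal U$. Let $\bar Z_N=\sum_{j}\beta^*(j)\sum_{k=1}^N\lambda_j(U_k,Y_k)$, let $D(\beta^*\|\tilde\rho_1)=\sum_j\beta^*(j)\log\frac{\beta^*(j)}{\tilde\rho_1(j)}$, and let $\mathrm{inv}_N(t)=\inf\{x\in\mathbb R: F(x)\ge t\}$, $t\in(0,1)$, be the quantile function of $\bar Z_N+D(\beta^*\|\tilde\rho_1)$ given $X=0$, where $F$ is its distribution function. \textbf{Theorem.} Suppose that the system is homogeneous, i.e. $p_0^u=p_0$ and $p_1^u=p_1$ do not depend on $u$. Then, whichever selection strategy $g$ is used to define the law of $\bar Z_N$: (i) (Converse) For all $N$, $\epsilon\in(0,1)$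 and $\eta>1$ with $\epsilon+\epsilon/\eta<1$, $$-\log\phi_N^*(\epsilon)\le \mathrm{inv}_N\Bigl(\epsilon+\frac{\epsilon}{\eta}\Bigr)+\log\frac{\eta}{\epsilon}.$$ (ii) (Achievability) If the moment generating function of $\log\frac{p_0(Y)}{p_1(Y)}$ under $Y\sim p_0$ is finite at some positive argument, i.e. $\int (p_0/p_1)^t\,p_0\,d\nu<\infty$ for some $t>0$, then there is a constant $C>0$, depending only on the system ($M$, $\nu$, $p_0$, $p_1$, $\rho_1$), such that for all $N$, $\epsilon\in(0,1)$ and $\eta>1$, $$-\log\phi_N^*(\epsilon)\ge \mathrm{inv}_N\Bigl(\epsilon-\frac{\epsilon}{\eta}\Bigr)-C\log\frac{\eta}{\epsilon}.$$ As $C$ does not depend on $N$, $\epsilon$ and $\eta$, both $\epsilon=\epsilon_N$ and $\eta=\eta_N$ may depend on $N$. -/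

import Mathlib

open MeasureTheory ProbabilityTheory
open scoped ENNReal NNReal

noncomputable section

namespace ActiveVerification

/-- A system with `M` components and observation space `𝒴`. The hypotheses are the elements of
`Option (Fin M)`: `none` says that there is no anomaly, `some j` that component `j` is anomalous.
`p 0 u` is the density (with respect to `ν`) of an observation of component `u` when `u` is not
anomalous, and `p 1 u` its density when `u` is anomalous. `prior` is the prior distribution of the
true hypothesis. -/
structure System (M : ℕ) (𝒴 : Type*) [MeasurableSpace 𝒴] where
  ν : Measure 𝒴
  sigmaFinite : SigmaFinite ν
  p : Fin 2 → Fin M → 𝒴 → ℝ≥0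
  measurable_p : ∀ k u, Measurable (p k u)
  lintegral_p : ∀ k u, ∫⁻ y, (p k u y : ℝ≥0∞) ∂ν = 1
  prior : Option (Fin M) → ℝ
  prior_mem : prior ∈ stdSimplex ℝ (Option (Fin M))

/-- The experiments and observations `(U_k, Y_k)` of the first `n` steps. -/
abbrev History (M : ℕ) (𝒴 : Type*) (n : ℕ) : Type _ := Fin n → Fin M × 𝒴

/-- An experiment selection strategy: `rule n` gives the (random) choice of the next component from
the first `n` experiments and observations. With a budget of `N` experiments, only the rules with
`n < N` play a role. -/
structure Selection (M : ℕ) (𝒴 : Type*) [MeasurableSpace 𝒴] where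
  rule : ∀ n : ℕ, Kernel (History M 𝒴 n) (Fin M)
  isMarkov : ∀ n, IsMarkovKernel (rule n)

/-- An inference strategy after `N` experiments: a (random) verdict in `Bool`, where `true` declares
the system safe and `false` declares it not safe. -/
structure Inference (M : ℕ) (𝒴 : Type*) [MeasurableSpace 𝒴] (N : ℕ) where
  rule : Kernel (History M 𝒴 N) Bool
  isMarkov : IsMarkovKernel rule

/-- Kullback–Leibler divergence of two distributions on a finite set. -/
def finKL {ι : Type*} [Fintype ι] (a b : ι → ℝ) : ℝ := ∑ i, a i * Real.log (a i / b i)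

/-- The quantile function `t ↦ inf {x | t ≤ F(x)}`, `F` being the distribution function of `μ`. -/
def quantile (μ : Measure ℝ) (t : ℝ) : ℝ := sInf {x : ℝ | t ≤ μ.real (Set.Iic x)}

namespace System

variable {M : ℕ} {𝒴 : Type*} [MeasurableSpace 𝒴] (S : System M 𝒴)

/-- The system is homogeneous: the densities do not depend on the component. -/
def Homogeneous : Prop := ∀ k u v, S.p k u = S.p k v

/-- The probability measure with density `p k u`. -/
def obsMeasure (k : Fin 2) (u : Fin M) : Measure 𝒴 :=
  S.ν.withDensity fun y => (S.p k u y : ℝ≥0∞)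

instance (k : Fin 2) (u : Fin M) : IsProbabilityMeasure (S.obsMeasure k u) :=
  ⟨by rw [obsMeasure, withDensity_apply _ MeasurableSet.univ, setLIntegral_univ, S.lintegral_p]⟩

/-- The conditional law of an observation given the selected component, under hypothesis `x`. -/
def obsKernel (x : Option (Fin M)) : Kernel (Fin M) 𝒴 where
  toFun u := S.obsMeasure (if x = some u then 1 else 0) u
  measurable' := measurable_of_countable _

instance (x : Option (Fin M)) : IsMarkovKernel (S.obsKernel x) :=
  ⟨fun u => inferInstanceAs
    (IsProbabilityMeasure (S.obsMeasure (if x = some u then 1 else 0) u))⟩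

/-- The conditional law of the next pair `(U, Y)` given the first `n` pairs. -/
def stepKernel (x : Option (Fin M)) (g : Selection M 𝒴) (n : ℕ) :
    Kernel (History M 𝒴 n) (Fin M × 𝒴) :=
  g.rule n ⊗ₖ Kernel.prodMkLeft (History M 𝒴 n) (S.obsKernel x)

instance (x : Option (Fin M)) (g : Selection M 𝒴) (n : ℕ) :
    IsMarkovKernel (S.stepKernel x g n) := by
  have := g.isMarkov n
  unfold stepKernel
  infer_instance

/-- The law of the first `n` experiments and observations under strategy `g`, given `X = x`. -/
def law (x : Option (Fin M)) (g : Selection M 𝒴) : (n : ℕ) → Measure (History M 𝒴 n)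
  | 0 => Measure.dirac Fin.elim0
  | n + 1 => (law x g n ⊗ₘ S.stepKernel x g n).map
      fun w => Fin.snoc (α := fun _ => Fin M × 𝒴) w.1 w.2

theorem measurable_snoc (n : ℕ) :
    Measurable fun w : History M 𝒴 n × (Fin M × 𝒴) =>
      (Fin.snoc (α := fun _ => Fin M × 𝒴) w.1 w.2 : History M 𝒴 (n + 1)) := by
  refine measurable_pi_lambda _ fun i => ?_
  refine Fin.lastCases ?_ (fun j => ?_) i
  · simpa only [Fin.snoc_last] using measurable_snd
  · simpa only [Fin.snoc_castSucc, Function.comp_def] using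
      (measurable_pi_apply j).comp measurable_fst

instance isProbabilityMeasure_law (x : Option (Fin M)) (g : Selection M 𝒴) (n : ℕ) :
    IsProbabilityMeasure (S.law x g n) := by
  induction n with
  | zero => exact inferInstanceAs (IsProbabilityMeasure (Measure.dirac _))
  | succ n ih => exact Measure.isProbabilityMeasure_map (measurable_snoc n).aemeasurable

/-- `ρ̃₁`: the prior distribution of the anomalous component, given that there is an anomaly. -/
def priorAnom (j : Fin M) : ℝ := S.prior (some j) / (1 - S.prior none)

/-- `P[X̂_N = safe | X = x]`. -/
def probSafe {N : ℕ} (x : Option (Fin M)) (f : Inference M 𝒴 N) (g : Selection M 𝒴) : ℝ≥0∞ :=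
  ∫⁻ h, f.rule h {true} ∂(S.law x g N)

/-- The correct-verification probability `ψ_N = P[X̂_N = safe | X = 0]`. -/
def psi {N : ℕ} (f : Inference M 𝒴 N) (g : Selection M 𝒴) : ℝ≥0∞ := S.probSafe none f g

/-- The incorrect-verification probability `φ_N = P[X̂_N = safe | X ≠ 0]`. -/
def phi {N : ℕ} (f : Inference M 𝒴 N) (g : Selection M 𝒴) : ℝ≥0∞ :=
  ∑ j, ENNReal.ofReal (S.priorAnom j) * S.probSafe (some j) f g

/-- `φ*_N`: the infimum of `φ_N` over all pairs of strategies with `ψ_N ≥ 1 - ε`. -/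
def phiStar (N : ℕ) (ε : ℝ) : ℝ≥0∞ :=
  sInf {r | ∃ (f : Inference M 𝒴 N) (g : Selection M 𝒴),
    ENNReal.ofReal (1 - ε) ≤ S.psi f g ∧ r = S.phi f g}

/-- `log (p₀ᵘ(y) / p₁ᵘ(y))` with values in the extended reals (`±∞` if exactly one density
vanishes). -/
def logRatio (u : Fin M) (y : 𝒴) : EReal := ENNReal.log ((S.p 0 u y : ℝ≥0∞) / (S.p 1 u y : ℝ≥0∞))

/-- Under either density, the log-likelihood ratio of each component is square integrable (in
particular almost surely finite). -/
def SquareIntegrable : Prop :=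
  ∀ (u : Fin M) (k : Fin 2), ∫⁻ y, (S.logRatio u y).abs ^ 2 * (S.p k u y : ℝ≥0∞) ∂S.ν < ∞

/-- The log-likelihood ratio `λ_j(u, y)` of hypothesis `0` against hypothesis `j`. -/
def llr (j u : Fin M) (y : 𝒴) : ℝ := if u = j then (S.logRatio u y).toReal else 0

/-- `D_j^u = E[λ_j(u, Y)]` for `Y ∼ p₀ᵘ`. -/
def div (j u : Fin M) : ℝ := ∫ y, S.llr j u y ∂(S.obsMeasure 0 u)

/-- `β` attains `min_β max_u ∑_j β(j) D_j^u`, the minimum being over the probability simplex. -/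
def IsMinimaxDist (β : Fin M → ℝ) : Prop :=
  β ∈ stdSimplex ℝ (Fin M) ∧
    IsMinOn (fun b : Fin M → ℝ => ⨆ u, ∑ j, b j * S.div j u) (stdSimplex ℝ (Fin M)) β

/-- The total log-likelihood ratio `Z_n(j)`. -/
def totalLLR {n : ℕ} (j : Fin M) (h : History M 𝒴 n) : ℝ := ∑ k, S.llr j (h k).1 (h k).2

/-- The weighted total log-likelihood ratio `Z̄_n = ∑_j β(j) Z_n(j)`. -/
def avgLLR {n : ℕ} (β : Fin M → ℝ) (h : History M 𝒴 n) : ℝ := ∑ j, β j * S.totalLLR j h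

/-- `inv_N`: the quantile function of `Z̄_N + D(β ‖ ρ̃₁)` under hypothesis `0` and strategy `g`. -/
def inv (β : Fin M → ℝ) (g : Selection M 𝒴) (N : ℕ) (t : ℝ) : ℝ :=
  quantile ((S.law none g N).map fun h => S.avgLLR β h + finKL β S.priorAnom) t

/-- Under `p₀ᵘ`, the moment generating function of the log-likelihood ratio of each component `u`
is finite at some positive argument. -/
def HasFiniteMGF : Prop :=
  ∀ u, ∃ t : ℝ, 0 < t ∧
    Integrable (fun y => Real.exp (t * S.llr u u y)) (S.obsMeasure 0 u)

end System

end ActiveVerification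

end

/-! Homogeneity makes `div` diagonal with equal entries, so the minimax `β` is uniform. Each
observation then moves the average log-likelihood ratio by 1/M times a log-ratio whose law is the
same for every component. Hence under the null hypothesis the law of W = Z̄ + D(β‖ρ̃) does not
depend on the strategy.

By change of measure (`lintegral_law_some`), φ is the null expectation of the acceptance probability
times the mixture ratio L = ∑ ρ̃(j) exp(-Z(j)). Jensen gives L ≥ exp(-W) for every strategy. On {W ≤
a} of probability at least ε + δ, a test of level ε accepts with mass at least δ, so φ ≥ δ exp(-a):
this is the converse, `le_phiStar`.

For achievability Jensen must be nearly tight, that is, the V(j) = Z(j) - log ρ̃(j) must stay close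
to each other. Always probing the least V(j) achieves this. An exponential potential of the gaps
mean(V) - V(j) satisfies a Foster–Lyapunov drift inequality, so its expectation is bounded uniformly
in time (`Homogeneous.exists_lintegral_gapPotential_le`). Except with probability K exp(-cs) all
gaps are below s, and then L ≤ exp(s - W). Thresholding L gives the bound with s of order log(1/δ),
where δ = ε/η. -/

namespace ActiveVerification

/-! ### Quantiles of a probability measure on the line. -/

section Quantile

variable (μ : Measure ℝ) [IsProbabilityMeasure μ] {t : ℝ}

theorem bddBelow_quantileSet (h0 : 0 < t) : BddBelow {x : ℝ | t ≤ μ.real (Set.Iic x)} := by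
  obtain ⟨a, ha⟩ := ((tendsto_cdf_atBot μ).eventually (gt_mem_nhds h0)).exists
  refine ⟨a, fun x hx => ?_⟩
  by_contra! hlt
  have h1 := monotone_cdf μ hlt.le
  rw [cdf_eq_real] at h1
  exact absurd (hx.trans h1) (not_le.mpr ha)

theorem quantileSet_nonempty (h1 : t < 1) : {x : ℝ | t ≤ μ.real (Set.Iic x)}.Nonempty := by
  obtain ⟨a, ha⟩ := ((tendsto_cdf_atTop μ).eventually (lt_mem_nhds h1)).exists
  exact ⟨a, by rw [Set.mem_ofPred_eq, ← cdf_eq_real]; exact ha.le⟩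

/-- Right continuity carries F ≥ t from the points above the quantile to the quantile itself. -/
theorem le_measureReal_Iic_quantile (h1 : t < 1) :
    t ≤ μ.real (Set.Iic (quantile μ t)) := by
  rw [← cdf_eq_real]
  have hr : Filter.Tendsto (cdf μ) (nhdsWithin (quantile μ t) (Set.Ioi (quantile μ t)))
      (nhds (cdf μ (quantile μ t))) :=
    ((cdf μ).right_continuous (quantile μ t)).tendsto.mono_left
      (nhdsWithin_mono _ Set.Ioi_subset_Ici_self)
  refine ge_of_tendsto hr ?_
  filter_upwards [self_mem_nhdsWithin] with x hx
  obtain ⟨y, hy, hyx⟩ := exists_lt_of_csInf_lt (quantileSet_nonempty μ h1) hx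
  rw [Set.mem_ofPred_eq, ← cdf_eq_real] at hy
  exact hy.trans (monotone_cdf μ hyx.le)

/-- F < t strictly below the quantile, and the open half-line has the left limit of F as its mass.
-/
theorem measureReal_Iio_quantile_le (h0 : 0 < t) : μ.real (Set.Iio (quantile μ t)) ≤ t := by
  have h2 : ∀ x < quantile μ t, cdf μ x ≤ t := fun x hx => by
    have := notMem_of_lt_csInf hx (bddBelow_quantileSet μ h0)
    rw [Set.mem_ofPred_eq, ← cdf_eq_real, not_le] at this
    exact this.le
  have h3 := (cdf μ).measure_Iio (tendsto_cdf_atBot μ) (quantile μ t)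
  rw [measure_cdf, sub_zero] at h3
  rw [measureReal_def, h3]
  refine ENNReal.toReal_le_of_le_ofReal h0.le (ENNReal.ofReal_le_ofReal ?_)
  have h4 := (monotone_cdf μ).tendsto_leftLim (quantile μ t)
  refine le_of_tendsto h4 ?_
  filter_upwards [self_mem_nhdsWithin] with x hx using h2 x hx

theorem quantile_mono {s : ℝ} (h0 : 0 < s) (hst : s ≤ t) (h1 : t < 1) :
    quantile μ s ≤ quantile μ t :=
  csInf_le_csInf (bddBelow_quantileSet μ h0) (quantileSet_nonempty μ h1)
    fun _ hx => hst.trans hx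

end Quantile

/-! ### The gap potential and its drift. -/

section Gap

variable {M : ℕ}

/-- The exponential potential of the gaps between the mean of `v` and its coordinates. -/
noncomputable def gapPotential (c : ℝ) (v : Fin M → ℝ) : ℝ :=
  ∑ j, Real.exp (c * ((∑ i, v i) / M - v j))

/-- The mean rises by x/M, so the gap of `i` falls by x(M-1)/M and every other gap rises by x/M. -/
theorem gapPotential_add_single (hM : 0 < M) (c : ℝ) (v : Fin M → ℝ) (i : Fin M) (x : ℝ) :
    gapPotential c (fun j => v j + if i = j then x else 0) =
      Real.exp (c / M * x) *
          (∑ j ∈ Finset.univ.erase i, Real.exp (c * ((∑ k, v k) / M - v j))) +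
        Real.exp (-(c * ((M - 1) / M)) * x) * Real.exp (c * ((∑ k, v k) / M - v i)) := by
  have hM' : (M : ℝ) ≠ 0 := by positivity
  have hsum : ∑ k, (v k + if i = k then x else 0) = ∑ k, v k + x := by
    simp [Finset.sum_add_distrib]
  rw [gapPotential, hsum, ← Finset.sum_erase_add _ _ (Finset.mem_univ i), Finset.mul_sum]
  congr 1
  · refine Finset.sum_congr rfl fun j hj => ?_
    rw [if_neg (Finset.ne_of_mem_erase hj).symm, ← Real.exp_add]
    congr 1
    field_simp
    ring
  · rw [if_pos rfl, ← Real.exp_add]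
    congr 1
    field_simp
    ring

/-- Drift condition for the potential when a least coordinate is incremented. -/
theorem exists_gapPotential_drift (hM : 0 < M) {a b c : ℝ} (hc : 0 < c) (ha : 1 ≤ a)
    (hb : 0 ≤ b) (hab : (M - 2 + Real.exp (-1)) * (a - 1) + (b - 1) < 0) :
    ∃ r B : ℝ, 0 ≤ r ∧ r < 1 ∧ 0 ≤ B ∧ ∀ (v : Fin M → ℝ) (i : Fin M), (∀ j, v i ≤ v j) →
      a * (∑ j ∈ Finset.univ.erase i, Real.exp (c * ((∑ k, v k) / M - v j))) +
        b * Real.exp (c * ((∑ k, v k) / M - v i)) ≤ r * gapPotential c v + B := by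
  have hM' : (0 : ℝ) < M := by positivity
  set h := (M - 2 + Real.exp (-1)) * (a - 1) + (b - 1) with hh
  have hB : 0 ≤ (a * M + b) * Real.exp 1 := by positivity
  -- When the largest gap is large, the change is at most hP ≤ (h/M)(Q + P), since h < 0 and P is
  -- the largest of M terms. Otherwise P ≤ e and everything is bounded by the constant.
  refine ⟨max (1 + h / M) 0, (a * M + b) * Real.exp 1, le_max_right _ _, ?_, hB, ?_⟩
  · rw [max_lt_iff]
    have := div_neg_of_neg_of_pos hab hM'
    constructor <;> linarith
  intro v i hi
  set m := (∑ k, v k) / M with hm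
  set P := Real.exp (c * (m - v i)) with hP
  set Q := ∑ j ∈ Finset.univ.erase i, Real.exp (c * (m - v j)) with hQ
  have hP0 : 0 < P := Real.exp_pos _
  have hQ0 : 0 ≤ Q := Finset.sum_nonneg fun j _ => (Real.exp_pos _).le
  have hle : ∀ j, Real.exp (c * (m - v j)) ≤ P := fun j => by
    apply Real.exp_le_exp.mpr
    have := hi j
    gcongr
  have hcard : ((Finset.univ.erase i).card : ℝ) = M - 1 := by
    rw [Finset.card_erase_of_mem (Finset.mem_univ i), Finset.card_univ, Fintype.card_fin,
      Nat.cast_sub hM, Nat.cast_one]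
  have hQP : Q ≤ (M - 1) * P := by
    rw [← hcard, ← nsmul_eq_mul]
    exact Finset.sum_le_card_nsmul _ _ _ fun j _ => hle j
  have hPhi : gapPotential c v = Q + P := by
    rw [gapPotential, ← Finset.sum_erase_add _ _ (Finset.mem_univ i)]
  have hPhi0 : 0 ≤ Q + P := by positivity
  rw [hPhi]
  have hr0 : 0 ≤ max (1 + h / M) 0 * (Q + P) := mul_nonneg (le_max_right _ _) hPhi0
  rcases lt_or_ge (c * (m - v i)) 1 with hG | hG
  · have hPe : P ≤ Real.exp 1 := Real.exp_le_exp.mpr hG.le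
    have h1 : a * Q + b * P ≤ (a * M + b) * P := by nlinarith
    have h2 : (a * M + b) * P ≤ (a * M + b) * Real.exp 1 := by gcongr
    linarith
  -- A coordinate at or above the mean contributes at most 1 ≤ exp(-1) P. This improves Q ≤ (M-1)P
  -- by (1 - exp(-1))P.
  · obtain ⟨k, -, hk⟩ : ∃ k ∈ Finset.univ, m ≤ v k := by
      refine Finset.exists_le_of_sum_le ⟨i, Finset.mem_univ i⟩ ?_
      simp only [Finset.sum_const, Finset.card_univ, Fintype.card_fin, nsmul_eq_mul, hm]
      rw [mul_div_cancel₀ _ hM'.ne']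
    have hki : k ∈ Finset.univ.erase i := by
      refine Finset.mem_erase.mpr ⟨?_, Finset.mem_univ k⟩
      rintro rfl
      nlinarith
    have hkle : Real.exp (c * (m - v k)) ≤ Real.exp (-1) * P := by
      rw [hP, ← Real.exp_add]
      apply Real.exp_le_exp.mpr
      nlinarith
    have hQ' : Q ≤ (M - 2 + Real.exp (-1)) * P := by
      rw [hQ, ← Finset.sum_erase_add _ _ hki]
      have hcard2 : (((Finset.univ.erase i).erase k).card : ℝ) = M - 2 := by
        rw [Finset.card_erase_of_mem hki, Nat.cast_sub (Finset.card_pos.mpr ⟨k, hki⟩), hcard]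
        push_cast
        ring
      have : ∑ j ∈ (Finset.univ.erase i).erase k, Real.exp (c * (m - v j)) ≤ (M - 2) * P := by
        rw [← hcard2, ← nsmul_eq_mul]
        exact Finset.sum_le_card_nsmul _ _ _ fun j _ => hle j
      linarith
    have h1 : a * Q + b * P ≤ (Q + P) + h * P := by nlinarith
    have h2 : h * P ≤ h / M * (Q + P) := by
      rw [div_mul_eq_mul_div, le_div_iff₀ hM']
      nlinarith
    have h3 : (1 + h / M) * (Q + P) ≤ max (1 + h / M) 0 * (Q + P) := by
      gcongr
      exact le_max_left _ _
    linarith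

open Classical in
/-- The first index at which a vector attains its minimum. -/
noncomputable def argminIndex (hM : 0 < M) (v : Fin M → ℝ) : Fin M :=
  (Finset.univ.filter fun i => ∀ j, v i ≤ v j).min' <| by
    obtain ⟨i, -, hi⟩ := Finset.exists_min_image Finset.univ v ⟨⟨0, hM⟩, Finset.mem_univ _⟩
    exact ⟨i, by simpa using hi⟩

theorem argminIndex_le (hM : 0 < M) (v : Fin M → ℝ) (j : Fin M) : v (argminIndex hM v) ≤ v j := by
  classical
  have h := Finset.min'_mem (Finset.univ.filter fun i => ∀ j, v i ≤ v j) (by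
    obtain ⟨i, -, hi⟩ := Finset.exists_min_image Finset.univ v ⟨⟨0, hM⟩, Finset.mem_univ _⟩
    exact ⟨i, by simpa using hi⟩)
  have h2 := (Finset.mem_filter.mp h).2 j
  unfold argminIndex
  convert h2

/-- Taking the first minimizer makes each fibre a finite Boolean combination of coordinate
inequalities. -/
theorem measurable_argminIndex (hM : 0 < M) : Measurable (argminIndex (M := M) hM) := by
  classical
  refine measurable_to_countable' fun i => ?_
  have : argminIndex hM ⁻¹' {i} =
      {v | (∀ j, v i ≤ v j) ∧ ∀ k < i, ¬ ∀ j, v k ≤ v j} := by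
    ext v
    simp only [Set.mem_preimage, Set.mem_singleton_iff, Set.mem_ofPred_eq]
    constructor
    · rintro rfl
      refine ⟨argminIndex_le hM v, fun k hk hk' => absurd hk (not_lt.mpr ?_)⟩
      exact Finset.min'_le _ _ (by simpa using hk')
    · rintro ⟨h1, h2⟩
      refine le_antisymm (Finset.min'_le _ _ (by simpa using h1)) ?_
      by_contra! hlt
      exact h2 _ hlt (argminIndex_le hM v)
  rw [this]
  measurability

end Gap

/-- For a random variable of positive mean with exponential moments, the moment generating function
satisfies the inequalities of the drift condition at some small scale. -/
theorem exists_mgf_drift {Ω : Type*} [MeasurableSpace Ω] {μ : Measure Ω} [IsProbabilityMeasure μ]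
    {X : Ω → ℝ} (h0 : (0 : ℝ) ∈ interior (integrableExpSet X μ)) (hX : 0 < μ[X])
    {M : ℕ} (hM : 0 < M) :
    ∃ c > 0, 1 ≤ mgf X μ (c / M) ∧ c / M ∈ integrableExpSet X μ ∧
      -(c * ((M - 1) / M)) ∈ integrableExpSet X μ ∧
      (M - 2 + Real.exp (-1)) * (mgf X μ (c / M) - 1) +
        (mgf X μ (-(c * ((M - 1) / M))) - 1) < 0 := by
  have hM' : (0 : ℝ) < M := by positivity
  have hd : HasDerivAt (mgf X μ) (μ[X]) 0 := by
    simpa using hasDerivAt_mgf h0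
  have hf1 : HasDerivAt (fun c : ℝ => c / M) (1 / M) 0 := (hasDerivAt_id 0).div_const _
  have hf2 : HasDerivAt (fun c : ℝ => -(c * ((M - 1) / M))) (-(1 * ((M - 1) / M))) 0 :=
    ((hasDerivAt_id 0).mul_const _).neg
  have hd1 : HasDerivAt (fun c : ℝ => mgf X μ (c / M)) (μ[X] * (1 / M)) 0 :=
    HasDerivAt.comp (h₂ := mgf X μ) 0 (by simpa using hd) hf1
  have hd2 : HasDerivAt (fun c : ℝ => mgf X μ (-(c * ((M - 1) / M))))
      (μ[X] * -(1 * ((M - 1) / M))) 0 :=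
    HasDerivAt.comp (h₂ := mgf X μ) 0 (by simpa using hd) hf2
  -- With M - 1 in place of M - 2 + exp(-1) the first-order terms would cancel; the saving makes the
  -- derivative negative.
  have hdt : HasDerivAt (fun c : ℝ => (M - 2 + Real.exp (-1)) * (mgf X μ (c / M) - 1) +
        (mgf X μ (-(c * ((M - 1) / M))) - 1)) ((Real.exp (-1) - 1) * μ[X] / M) 0 := by
    refine (((hd1.sub_const 1).const_mul (M - 2 + Real.exp (-1))).add
      (hd2.sub_const 1)).congr_deriv ?_
    field_simp
    ring
  have e1 : ∀ᶠ c : ℝ in nhdsWithin (0 : ℝ) (Set.Ioi 0), 1 ≤ mgf X μ (c / (M : ℝ)) := by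
    have := (hasDerivAt_iff_tendsto_slope.mp hd1).mono_left
      (nhdsWithin_mono 0 (fun x (hx : x ∈ Set.Ioi (0 : ℝ)) => (ne_of_gt hx)))
    filter_upwards [this.eventually (lt_mem_nhds (show 0 < μ[X] * (1 / (M : ℝ)) by positivity)),
      self_mem_nhdsWithin] with c hc hc0
    rw [slope_def_field] at hc
    simp only [sub_zero, zero_div, mgf_zero] at hc
    have := (div_pos_iff_of_pos_right hc0).mp hc
    linarith
  have hexp : Real.exp (-1) < 1 := by simp
  have e2 : ∀ᶠ c : ℝ in nhdsWithin (0 : ℝ) (Set.Ioi 0),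
      (M - 2 + Real.exp (-1)) * (mgf X μ (c / M) - 1) +
        (mgf X μ (-(c * ((M - 1) / M))) - 1) < 0 := by
    have := (hasDerivAt_iff_tendsto_slope.mp hdt).mono_left
      (nhdsWithin_mono 0 (fun x (hx : x ∈ Set.Ioi (0 : ℝ)) => (ne_of_gt hx)))
    have hneg : (Real.exp (-1) - 1) * μ[X] / M < 0 :=
      div_neg_of_neg_of_pos (mul_neg_of_neg_of_pos (by linarith) hX) hM'
    filter_upwards [this.eventually (gt_mem_nhds hneg), self_mem_nhdsWithin] with c hc hc0
    rw [slope_def_field] at hc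
    simp only [sub_zero, zero_div, zero_mul, neg_zero, mgf_zero, sub_self, mul_zero,
      add_zero] at hc
    have := (div_lt_iff₀ (show (0 : ℝ) < c from hc0)).mp hc
    linarith
  have hnhds : integrableExpSet X μ ∈ nhds (0 : ℝ) := mem_interior_iff_mem_nhds.mp h0
  have e3 : ∀ᶠ c : ℝ in nhdsWithin (0 : ℝ) (Set.Ioi 0), c / M ∈ integrableExpSet X μ :=
    (hf1.continuousAt.tendsto.mono_left nhdsWithin_le_nhds)
      (by simpa only [zero_div, zero_mul, neg_zero] using hnhds)
  have e4 : ∀ᶠ c : ℝ in nhdsWithin (0 : ℝ) (Set.Ioi 0),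
      -(c * ((M - 1) / M)) ∈ integrableExpSet X μ :=
    (hf2.continuousAt.tendsto.mono_left nhdsWithin_le_nhds)
      (by simpa only [zero_div, zero_mul, neg_zero] using hnhds)
  obtain ⟨c, ⟨⟨⟨h1, h2⟩, h3⟩, h4⟩, h5⟩ :=
    ((((e1.and e2).and e3).and e4).and self_mem_nhdsWithin).exists
  exact ⟨c, h5, h1, h3, h4, h2⟩

namespace System

variable {M : ℕ} {𝒴 : Type*} [MeasurableSpace 𝒴] (S : System M 𝒴)

/-! ### Likelihood ratios of single observations. -/

section Density

theorem measurable_logRatio (u : Fin M) : Measurable (S.logRatio u) :=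
  ENNReal.measurable_log.comp
    ((S.measurable_p 0 u).coe_nnreal_ennreal.div (S.measurable_p 1 u).coe_nnreal_ennreal)

theorem measurable_llr (j u : Fin M) : Measurable (S.llr j u) := by
  unfold llr
  by_cases h : u = j
  · simpa [h] using (S.measurable_logRatio _).ereal_toReal
  · simp [h]

theorem llr_self (u : Fin M) (y : 𝒴) : S.llr u u y = (S.logRatio u y).toReal := if_pos rfl

theorem llr_of_ne {j u : Fin M} (h : u ≠ j) (y : 𝒴) : S.llr j u y = 0 := if_neg h

/-- A set on which the likelihood ratio is infinite and one of the densities positive is null. -/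
theorem measure_eq_zero_of_abs_logRatio_eq_top (hsq : S.SquareIntegrable) (u : Fin M) (k : Fin 2)
    {A : Set 𝒴} (hA : MeasurableSet A)
    (h : ∀ y ∈ A, (S.logRatio u y).abs = ∞ ∧ S.p k u y ≠ 0) : S.ν A = 0 := by
  by_contra hne
  have h1 : ∫⁻ y, A.indicator (fun _ => ∞) y ∂S.ν ≤
      ∫⁻ y, (S.logRatio u y).abs ^ 2 * (S.p k u y : ℝ≥0∞) ∂S.ν := by
    refine lintegral_mono fun y => ?_
    by_cases hy : y ∈ A
    · rw [Set.indicator_of_mem hy, (h y hy).1]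
      simp [ENNReal.top_mul, (h y hy).2]
    · simp [hy]
  rw [lintegral_indicator_const hA, ENNReal.top_mul hne] at h1
  exact absurd (h1.trans_lt (hsq u k)) (lt_irrefl _)

/-- Where exactly one density vanishes the log-ratio is infinite, which square integrability forbids
off a null set. Where both vanish, both sides are 0. -/
theorem density_one_eq (hsq : S.SquareIntegrable) (u : Fin M) :
    ∀ᵐ y ∂S.ν, (S.p 1 u y : ℝ≥0∞) =
      (S.p 0 u y : ℝ≥0∞) * ENNReal.ofReal (Real.exp (-S.llr u u y)) := by
  have hm0 : MeasurableSet {y | S.p 0 u y = 0} := S.measurable_p 0 u (measurableSet_singleton 0)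
  have hm1 : MeasurableSet {y | S.p 1 u y = 0} := S.measurable_p 1 u (measurableSet_singleton 0)
  have h1 : S.ν ({y | S.p 0 u y = 0} ∩ {y | S.p 1 u y = 0}ᶜ) = 0 := by
    refine S.measure_eq_zero_of_abs_logRatio_eq_top hsq u 1 (hm0.inter hm1.compl) ?_
    rintro y ⟨h0 : S.p 0 u y = 0, h1 : ¬ S.p 1 u y = 0⟩
    refine ⟨?_, h1⟩
    simp [logRatio, h0]
  have h2 : S.ν ({y | S.p 0 u y = 0}ᶜ ∩ {y | S.p 1 u y = 0}) = 0 := by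
    refine S.measure_eq_zero_of_abs_logRatio_eq_top hsq u 0 (hm0.compl.inter hm1) ?_
    rintro y ⟨h0 : ¬ S.p 0 u y = 0, h1 : S.p 1 u y = 0⟩
    refine ⟨?_, h0⟩
    have : (S.p 0 u y : ℝ≥0∞) ≠ 0 := by simpa using h0
    simp [logRatio, h1, ENNReal.div_zero this]
  filter_upwards [measure_eq_zero_iff_ae_notMem.mp h1, measure_eq_zero_iff_ae_notMem.mp h2]
    with y hy1 hy2
  by_cases h0 : S.p 0 u y = 0
  · have : S.p 1 u y = 0 := by
      by_contra hne
      exact hy1 ⟨h0, hne⟩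
    simp [h0, this]
  · have h1 : S.p 1 u y ≠ 0 := fun h => hy2 ⟨h0, h⟩
    have hpos0 : (0 : ℝ) < S.p 0 u y := by positivity
    have hpos1 : (0 : ℝ) < S.p 1 u y := by positivity
    have hlog : S.logRatio u y = ((Real.log (S.p 0 u y / S.p 1 u y) : ℝ) : EReal) := by
      rw [logRatio, ← ENNReal.coe_div h1, ENNReal.log_of_nnreal (by positivity)]
      simp
    rw [llr_self, hlog, EReal.toReal_coe, Real.exp_neg, Real.exp_log (by positivity), inv_div,
      ← ENNReal.ofReal_coe_nnreal, ← ENNReal.ofReal_coe_nnreal,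
      ← ENNReal.ofReal_mul hpos0.le, mul_div_cancel₀ _ hpos0.ne']

theorem lintegral_obsMeasure (k : Fin 2) (u : Fin M) {F : 𝒴 → ℝ≥0∞} (hF : Measurable F) :
    ∫⁻ y, F y ∂S.obsMeasure k u = ∫⁻ y, (S.p k u y : ℝ≥0∞) * F y ∂S.ν := by
  rw [obsMeasure, lintegral_withDensity_eq_lintegral_mul _
    (S.measurable_p k u).coe_nnreal_ennreal hF]
  rfl

theorem lintegral_obsKernel_some (hsq : S.SquareIntegrable) (j u : Fin M) {F : 𝒴 → ℝ≥0∞}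
    (hF : Measurable F) :
    ∫⁻ y, F y ∂S.obsKernel (some j) u =
      ∫⁻ y, F y * ENNReal.ofReal (Real.exp (-S.llr j u y)) ∂S.obsKernel none u := by
  change ∫⁻ y, F y ∂S.obsMeasure (if some j = some u then 1 else 0) u =
    ∫⁻ y, _ ∂S.obsMeasure 0 u
  by_cases h : j = u
  · subst h
    rw [if_pos rfl, lintegral_obsMeasure _ _ _ hF, lintegral_obsMeasure _ _ _
      (hF.fun_mul (S.measurable_llr j j).fun_neg.exp.ennreal_ofReal)]
    refine lintegral_congr_ae ?_
    filter_upwards [S.density_one_eq hsq j] with y hy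
    rw [hy]
    ring
  · rw [if_neg (by simpa using h)]
    simp [S.llr_of_ne (Ne.symm h)]

end Density

/-! ### Laws of histories and change of measure. -/

section Law

theorem lintegral_law_succ (x : Option (Fin M)) (g : Selection M 𝒴) (n : ℕ)
    {F : History M 𝒴 (n + 1) → ℝ≥0∞} (hF : Measurable F) :
    ∫⁻ h, F h ∂S.law x g (n + 1) = ∫⁻ h, ∫⁻ u, ∫⁻ y,
      F (Fin.snoc (α := fun _ => Fin M × 𝒴) h (u, y)) ∂S.obsKernel x u ∂g.rule n h
        ∂S.law x g n := by
  have := g.isMarkov n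
  have hF' : Measurable fun w : History M 𝒴 n × (Fin M × 𝒴) =>
      F (Fin.snoc (α := fun _ => Fin M × 𝒴) w.1 w.2) := hF.comp (measurable_snoc n)
  rw [law, lintegral_map hF (measurable_snoc n), Measure.lintegral_compProd hF']
  refine lintegral_congr fun h => ?_
  exact Kernel.lintegral_compProd _ _ _ (hF'.comp measurable_prodMk_left)

theorem measurable_totalLLR {n : ℕ} (j : Fin M) :
    Measurable (S.totalLLR j : History M 𝒴 n → ℝ) := by
  refine Finset.measurable_fun_sum _ fun k _ => ?_
  have h : Measurable fun w : Fin M × 𝒴 => S.llr j w.1 w.2 :=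
    measurable_from_prod_countable_right fun u => S.measurable_llr j u
  exact h.comp (measurable_pi_apply k)

theorem measurable_avgLLR {n : ℕ} (β : Fin M → ℝ) :
    Measurable (S.avgLLR β : History M 𝒴 n → ℝ) :=
  Finset.measurable_fun_sum _ fun j _ => (S.measurable_totalLLR j).const_mul _

theorem totalLLR_snoc {n : ℕ} (j : Fin M) (h : History M 𝒴 n) (u : Fin M) (y : 𝒴) :
    S.totalLLR j (Fin.snoc (α := fun _ => Fin M × 𝒴) h (u, y) : History M 𝒴 (n + 1)) =
      S.totalLLR j h + S.llr j u y := by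
  simp [totalLLR, Fin.sum_univ_castSucc]

theorem avgLLR_snoc {n : ℕ} (β : Fin M → ℝ) (h : History M 𝒴 n) (u : Fin M) (y : 𝒴) :
    S.avgLLR β (Fin.snoc (α := fun _ => Fin M × 𝒴) h (u, y) : History M 𝒴 (n + 1)) =
      S.avgLLR β h + β u * S.llr u u y := by
  simp only [avgLLR, totalLLR_snoc, mul_add, Finset.sum_add_distrib]
  congr 1
  rw [Finset.sum_eq_single u]
  · intro j _ hj
    rw [S.llr_of_ne hj.symm, mul_zero]
  · simp

/-- Change of measure: the law under hypothesis `j` has density `exp (-Z_n(j))` with respect to the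
law under the null hypothesis. -/
theorem lintegral_law_some (hsq : S.SquareIntegrable) (g : Selection M 𝒴) (j : Fin M) (n : ℕ)
    {F : History M 𝒴 n → ℝ≥0∞} (hF : Measurable F) :
    ∫⁻ h, F h ∂S.law (some j) g n =
      ∫⁻ h, F h * ENNReal.ofReal (Real.exp (-S.totalLLR j h)) ∂S.law none g n := by
  induction n with
  | zero => simp [law, totalLLR]
  | succ n ih =>
    have hm : ∀ {k : ℕ}, Measurable fun h : History M 𝒴 k =>
        ENNReal.ofReal (Real.exp (-S.totalLLR j h)) :=
      fun {_} => (S.measurable_totalLLR j).fun_neg.exp.ennreal_ofReal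
    have := g.isMarkov n
    have hsn := measurable_snoc (M := M) (𝒴 := 𝒴) n
    -- The selection kernel is the same under both hypotheses, so only the observation contributes a
    -- new factor.
    rw [S.lintegral_law_succ _ _ _ hF, S.lintegral_law_succ _ _ _ (hF.fun_mul hm), ih]
    · refine lintegral_congr fun h => ?_
      rw [← lintegral_mul_const' _ _ ENNReal.ofReal_ne_top]
      refine lintegral_congr fun u => ?_
      have hF2 : Measurable fun y =>
          F (Fin.snoc (α := fun _ => Fin M × 𝒴) h (u, y)) :=
        hF.comp (hsn.comp (measurable_prodMk_left.comp measurable_prodMk_left))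
      rw [S.lintegral_obsKernel_some hsq _ _ hF2, ← lintegral_mul_const' _ _ ENNReal.ofReal_ne_top]
      refine lintegral_congr fun y => ?_
      rw [totalLLR_snoc, neg_add, Real.exp_add, ENNReal.ofReal_mul (Real.exp_pos _).le]
      ring
    · have h3 : Measurable fun w : History M 𝒴 n × Fin M => ∫⁻ y,
          F (Fin.snoc (α := fun _ => Fin M × 𝒴) w.1 (w.2, y)) ∂S.obsKernel (some j) w.2 := by
        refine Measurable.lintegral_kernel_prod_right'
          (κ := Kernel.prodMkLeft (History M 𝒴 n) (S.obsKernel (some j)))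
          (f := fun p : (History M 𝒴 n × Fin M) × 𝒴 =>
            F (Fin.snoc (α := fun _ => Fin M × 𝒴) p.1.1 (p.1.2, p.2))) ?_
        have h4 : Measurable fun p : (History M 𝒴 n × Fin M) × 𝒴 => (p.1.1, (p.1.2, p.2)) := by
          fun_prop
        exact hF.comp (hsn.comp h4)
      exact Measurable.lintegral_kernel_prod_right' h3

end Law

/-! ### Consequences of homogeneity. -/

section Homogeneous

variable {S}

theorem Homogeneous.obsMeasure_eq (hhom : S.Homogeneous) (k : Fin 2) (u v : Fin M) :
    S.obsMeasure k u = S.obsMeasure k v := by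
  rw [obsMeasure, hhom k u v, obsMeasure]

theorem Homogeneous.llr_eq (hhom : S.Homogeneous) (u v : Fin M) (y : 𝒴) :
    S.llr u u y = S.llr v v y := by
  rw [llr_self, llr_self, logRatio, logRatio, hhom 0 u v, hhom 1 u v]

theorem Homogeneous.div_eq (hhom : S.Homogeneous) (u v : Fin M) : S.div u u = S.div v v := by
  simp only [div, hhom.llr_eq u v, hhom.obsMeasure_eq 0 u v]

/-- In a homogeneous system, a minimax distribution is uniform. -/
theorem Homogeneous.minimaxDist_eq (hhom : S.Homogeneous) (hM : 0 < M)
    (hdiv : ∀ u, 0 < S.div u u) {β : Fin M → ℝ} (hβ : S.IsMinimaxDist β) (u : Fin M) :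
    β u = 1 / M := by
  have hM' : (0 : ℝ) < M := by positivity
  have : Nonempty (Fin M) := ⟨u⟩
  -- Off-diagonal divergences vanish, so the minimax objective is the common divergence times the
  -- largest weight.
  have hD : ∀ (b : Fin M → ℝ) v, ∑ j, b j * S.div j v = b v * S.div u u := fun b v => by
    rw [Finset.sum_eq_single v, hhom.div_eq v u]
    · intro j _ hj
      have : S.div j v = 0 := by simp [div, S.llr_of_ne hj.symm]
      rw [this, mul_zero]
    · simp
  obtain ⟨⟨-, hsum⟩, hmin⟩ := hβ
  have hunif : (fun _ => 1 / (M : ℝ)) ∈ stdSimplex ℝ (Fin M) :=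
    ⟨fun _ => by positivity, by simp [hM'.ne']⟩
  have h1 := hmin hunif
  simp only [Set.mem_ofPred_eq, hD, ciSup_const] at h1
  have h2 : ∀ v, β v ≤ 1 / M := fun v => by
    have h3 := (le_ciSup (f := fun v => β v * S.div u u) (Set.finite_range _).bddAbove v).trans h1
    exact le_of_mul_le_mul_right h3 (hdiv u)
  have h4 : ∑ v, (1 / (M : ℝ) - β v) = 0 := by
    simp [Finset.sum_sub_distrib, hsum, hM'.ne']
  have h5 := (Finset.sum_eq_zero_iff_of_nonneg fun v _ => sub_nonneg.mpr (h2 v)).mp h4 u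
    (Finset.mem_univ u)
  linarith

/-- In a homogeneous system, the law of the average log-likelihood ratio under the null hypothesis
does not depend on the selection strategy. -/
theorem Homogeneous.lintegral_avgLLR (hhom : S.Homogeneous) {b : ℝ}
    {β : Fin M → ℝ} (hβ : ∀ u, β u = b) (g g' : Selection M 𝒴) (n : ℕ) {F : ℝ → ℝ≥0∞}
    (hF : Measurable F) :
    ∫⁻ h, F (S.avgLLR β h) ∂S.law none g n = ∫⁻ h, F (S.avgLLR β h) ∂S.law none g' n := by
  induction n generalizing F with
  | zero => rfl
  | succ n ih =>
    rcases isEmpty_or_nonempty (Fin M) with hM | ⟨⟨v⟩⟩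
    · have : IsEmpty (History M 𝒴 (n + 1)) := ⟨fun h => hM.elim (h 0).1⟩
      simp
    -- The increment has the same law whichever component is drawn, so the selection kernel
    -- integrates out.
    have key : ∀ g : Selection M 𝒴, ∫⁻ h, F (S.avgLLR β h) ∂S.law none g (n + 1) =
        ∫⁻ h, (fun x => ∫⁻ y, F (x + b * S.llr v v y) ∂S.obsMeasure 0 v)
          (S.avgLLR β h) ∂S.law none g n := fun g => by
      have := g.isMarkov n
      have hm : Measurable fun h : History M 𝒴 (n + 1) => F (S.avgLLR β h) :=
        hF.comp (S.measurable_avgLLR β)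
      rw [S.lintegral_law_succ _ _ _ hm]
      refine lintegral_congr fun h => ?_
      have h1 : ∀ u, ∫⁻ y, F (S.avgLLR β (Fin.snoc (α := fun _ => Fin M × 𝒴) h (u, y) :
          History M 𝒴 (n + 1))) ∂S.obsKernel none u =
          ∫⁻ y, F (S.avgLLR β h + b * S.llr v v y) ∂S.obsMeasure 0 v := fun u => by
        change ∫⁻ y, _ ∂S.obsMeasure 0 u = _
        rw [hhom.obsMeasure_eq 0 u v]
        refine lintegral_congr fun y => ?_
        rw [avgLLR_snoc, hβ, hhom.llr_eq u v]
      simp [h1]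
    rw [key, key]
    refine ih (F := fun x => ∫⁻ y, F (x + b * S.llr v v y) ∂S.obsMeasure 0 v) ?_
    have hl := S.measurable_llr v v
    exact Measurable.lintegral_prod_right' (f := fun p : ℝ × 𝒴 => F (p.1 + b * S.llr v v p.2))
      (by fun_prop)

theorem Homogeneous.map_avgLLR_eq (hhom : S.Homogeneous) {b : ℝ}
    {β : Fin M → ℝ} (hβ : ∀ u, β u = b) (g g' : Selection M 𝒴) (n : ℕ) (K : ℝ) :
    (S.law none g n).map (fun h => S.avgLLR β h + K) =
      (S.law none g' n).map (fun h => S.avgLLR β h + K) := by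
  have hm : Measurable fun h : History M 𝒴 n => S.avgLLR β h + K :=
    (S.measurable_avgLLR β).add_const K
  refine Measure.ext_of_lintegral _ fun F hF => ?_
  rw [lintegral_map hF hm, lintegral_map hF hm]
  exact hhom.lintegral_avgLLR hβ g g' n (F := fun x => F (x + K)) (by fun_prop)

end Homogeneous

/-! ### The prior and the mixture likelihood ratio. -/

section Prior

theorem sum_prior_some : ∑ j, S.prior (some j) = 1 - S.prior none := by
  have := S.prior_mem.2
  rw [Fintype.sum_option] at this
  linarith

theorem one_sub_prior_none_pos (hM : 0 < M) (hprior : ∀ j, 0 < S.prior (some j)) :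
    0 < 1 - S.prior none := by
  rw [← S.sum_prior_some]
  exact Finset.sum_pos (fun j _ => hprior j) ⟨⟨0, hM⟩, Finset.mem_univ _⟩

theorem priorAnom_pos (hM : 0 < M) (hprior : ∀ j, 0 < S.prior (some j)) (j : Fin M) :
    0 < S.priorAnom j :=
  div_pos (hprior j) (S.one_sub_prior_none_pos hM hprior)

end Prior

/-- The likelihood ratio of the mixture of the anomalous hypotheses against the null hypothesis. -/
noncomputable def mixtureLR {n : ℕ} (h : History M 𝒴 n) : ℝ :=
  ∑ j, S.priorAnom j * Real.exp (-S.totalLLR j h)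

theorem measurable_mixtureLR {n : ℕ} : Measurable (S.mixtureLR : History M 𝒴 n → ℝ) :=
  Finset.measurable_fun_sum _ fun j _ => (S.measurable_totalLLR j).fun_neg.exp.const_mul _

theorem phi_eq_lintegral (hsq : S.SquareIntegrable) (hρ : ∀ j, 0 < S.priorAnom j) {N : ℕ}
    (f : Inference M 𝒴 N) (g : Selection M 𝒴) :
    S.phi f g = ∫⁻ h, f.rule h {true} * ENNReal.ofReal (S.mixtureLR h) ∂S.law none g N := by
  have hf : Measurable fun h => f.rule h {true} := f.rule.measurable_coe (measurableSet_singleton _)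
  have hm : ∀ j, Measurable fun h : History M 𝒴 N =>
      f.rule h {true} * ENNReal.ofReal (Real.exp (-S.totalLLR j h)) := fun j =>
    hf.fun_mul (S.measurable_totalLLR j).fun_neg.exp.ennreal_ofReal
  simp only [phi, probSafe, S.lintegral_law_some hsq g _ N hf]
  simp_rw [← fun j => lintegral_const_mul (μ := S.law none g N)
    (ENNReal.ofReal (S.priorAnom j)) (hm j)]
  rw [← lintegral_finsetSum _ fun j _ => (hm j).const_mul _]
  refine lintegral_congr fun h => ?_
  rw [mixtureLR, ENNReal.ofReal_sum_of_nonneg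
    fun j _ => mul_nonneg (hρ j).le (Real.exp_pos _).le, Finset.mul_sum]
  refine Finset.sum_congr rfl fun j _ => ?_
  rw [ENNReal.ofReal_mul (hρ j).le]
  ring

/-- Jensen's inequality for the mixture likelihood ratio. -/
theorem exp_neg_avgLLR_add_finKL_le (hρ : ∀ j, 0 < S.priorAnom j) {β : Fin M → ℝ}
    (hβ : ∀ j, 0 < β j) (hβ1 : ∑ j, β j = 1) {n : ℕ} (h : History M 𝒴 n) :
    Real.exp (-(S.avgLLR β h + finKL β S.priorAnom)) ≤ S.mixtureLR h := by
  -- The shift by log(β/ρ̃) turns the weights β into ρ̃ outside the exponential, and its β-mean is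
  -- the divergence.
  have := convexOn_exp.map_sum_le (t := Finset.univ) (w := β)
    (p := fun j => -S.totalLLR j h - Real.log (β j / S.priorAnom j))
    (fun j _ => (hβ j).le) hβ1 (fun _ _ => Set.mem_univ _)
  refine (le_of_eq ?_).trans (this.trans (le_of_eq ?_))
  · congr 1
    simp only [avgLLR, finKL, smul_eq_mul, mul_sub, Finset.sum_sub_distrib, mul_neg,
      Finset.sum_neg_distrib]
    rw [neg_add, ← sub_eq_add_neg]
  · refine Finset.sum_congr rfl fun j _ => ?_
    have h1 := hβ j
    have h2 := hρ j
    rw [Real.exp_sub, Real.exp_log (by positivity), smul_eq_mul]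
    field_simp

/-! ### Converse bound. -/

section Converse

/-- Lower bound on the incorrect-verification probability of strategies with correct-verification
probability at least `1 - ε`. -/
theorem le_phiStar (hsq : S.SquareIntegrable) (hρ : ∀ j, 0 < S.priorAnom j)
    {β : Fin M → ℝ} (hβ : ∀ j, 0 < β j) (hβ1 : ∑ j, β j = 1) {N : ℕ} {ε δ a : ℝ}
    (h1 : ε + δ < 1)
    (ha : ∀ g, ε + δ ≤ ((S.law none g N).map fun h =>
      S.avgLLR β h + finKL β S.priorAnom).real (Set.Iic a)) :
    ENNReal.ofReal (Real.exp (-a) * δ) ≤ S.phiStar N ε := by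
  refine le_sInf ?_
  rintro _ ⟨f, g, hψ, rfl⟩
  have hf : Measurable fun h => f.rule h {true} := f.rule.measurable_coe (measurableSet_singleton _)
  have hW : Measurable fun h : History M 𝒴 N => S.avgLLR β h + finKL β S.priorAnom :=
    (S.measurable_avgLLR β).add_const _
  set A : Set (History M 𝒴 N) :=
    (fun h : History M 𝒴 N => S.avgLLR β h + finKL β S.priorAnom) ⁻¹' Set.Iic a with hA
  have hAm : MeasurableSet A := hW measurableSet_Iic
  have hcompl : S.law none g N Aᶜ ≤ ENNReal.ofReal (1 - (ε + δ)) := by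
    have h2 := ha g
    rw [map_measureReal_apply hW measurableSet_Iic] at h2
    rw [← ofReal_measureReal, probReal_compl_eq_one_sub hAm]
    exact ENNReal.ofReal_le_ofReal (by linarith)
  have hfle : ∀ h, f.rule h {true} ≤ 1 := fun h => by
    have := f.isMarkov
    exact prob_le_one
  -- Of the acceptance mass 1 - ε, at most 1 - (ε + δ) can lie outside `A`.
  have hψ' : ENNReal.ofReal δ ≤ ∫⁻ h in A, f.rule h {true} ∂S.law none g N := by
    have h3 : S.psi f g ≤ (∫⁻ h in A, f.rule h {true} ∂S.law none g N) +
        ENNReal.ofReal (1 - (ε + δ)) := by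
      rw [psi, probSafe, ← lintegral_add_compl _ hAm]
      gcongr
      refine le_trans ?_ hcompl
      rw [← setLIntegral_one]
      exact lintegral_mono fun h => hfle h
    have h4 := hψ.trans h3
    rw [show 1 - ε = δ + (1 - (ε + δ)) by ring] at h4
    rcases le_or_gt δ 0 with hδ | hδ
    · simp [ENNReal.ofReal_of_nonpos hδ]
    rw [ENNReal.ofReal_add hδ.le (by linarith)] at h4
    exact (ENNReal.add_le_add_iff_right ENNReal.ofReal_ne_top).mp h4
  rw [S.phi_eq_lintegral hsq hρ, ENNReal.ofReal_mul (Real.exp_pos _).le]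
  calc ENNReal.ofReal (Real.exp (-a)) * ENNReal.ofReal δ
      ≤ ENNReal.ofReal (Real.exp (-a)) * ∫⁻ h in A, f.rule h {true} ∂S.law none g N := by gcongr
    _ = ∫⁻ h in A, ENNReal.ofReal (Real.exp (-a)) * f.rule h {true} ∂S.law none g N :=
        (lintegral_const_mul _ hf).symm
    _ ≤ ∫⁻ h in A, f.rule h {true} * ENNReal.ofReal (S.mixtureLR h) ∂S.law none g N := by
        refine setLIntegral_mono' hAm fun h hh => ?_
        rw [mul_comm]
        gcongr
        refine le_trans (Real.exp_le_exp.mpr (neg_le_neg ?_))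
          (S.exp_neg_avgLLR_add_finKL_le hρ hβ hβ1 h)
        exact hh
    _ ≤ _ := setLIntegral_le_lintegral _ _

end Converse

/-! ### Randomized threshold test. -/

section Test

/-- A randomized likelihood-ratio test. -/
theorem phiStar_le_of_measure_le (hsq : S.SquareIntegrable) (hρ : ∀ j, 0 < S.priorAnom j)
    (g : Selection M 𝒴) {N : ℕ} {τ ε ε' : ℝ} (hε1 : ε < 1) (hle : ε ≤ ε')
    (hε' : ε' < 1)
    (hA : S.law none g N {h | Real.exp (-τ) < S.mixtureLR h} ≤ ENNReal.ofReal ε) (hε : 0 ≤ ε) :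
    S.phiStar N ε' ≤ ENNReal.ofReal ((1 - ε') / (1 - ε) * Real.exp (-τ)) := by
  -- Accepting only with probability `α` below the threshold lowers the guaranteed ψ from 1 - ε to 1
  -- - ε' and scales the bound on φ by the same factor.
  set α : ℝ≥0 := ⟨(1 - ε') / (1 - ε), div_nonneg (by linarith) (by linarith)⟩ with hα
  have hαv : (α : ℝ) = (1 - ε') / (1 - ε) := rfl
  have hα1' : (α : ℝ≥0∞) ≤ 1 := by
    rw [ENNReal.coe_le_one_iff, ← NNReal.coe_le_coe, hαv, NNReal.coe_one, div_le_one (by linarith)]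
    linarith
  have hm : MeasurableSet {h : History M 𝒴 N | S.mixtureLR h ≤ Real.exp (-τ)} :=
    S.measurable_mixtureLR measurableSet_Iic
  classical
  let m : Measure Bool :=
    (α : ℝ≥0∞) • Measure.dirac true + (1 - (α : ℝ≥0∞)) • Measure.dirac false
  have : IsProbabilityMeasure m := ⟨by simpa [m] using add_tsub_cancel_of_le hα1'⟩
  let κ : Kernel (History M 𝒴 N) Bool :=
    Kernel.piecewise hm (Kernel.const _ m) (Kernel.const _ (Measure.dirac false))
  have hκ : IsMarkovKernel κ := inferInstanceAs (IsMarkovKernel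
    (Kernel.piecewise hm (Kernel.const _ m) (Kernel.const _ (Measure.dirac false))))
  let f : Inference M 𝒴 N := ⟨κ, hκ⟩
  have hf : ∀ h, f.rule h {true} =
      {h : History M 𝒴 N | S.mixtureLR h ≤ Real.exp (-τ)}.indicator (fun _ => (α : ℝ≥0∞)) h := by
    intro h
    change κ h {true} = _
    by_cases hh : S.mixtureLR h ≤ Real.exp (-τ)
    · simp [κ, Kernel.piecewise_apply, hh, Set.indicator, m]
    · simp [κ, Kernel.piecewise_apply, hh, Set.indicator]
  have hψ : ENNReal.ofReal (1 - ε') ≤ S.psi f g := by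
    simp only [psi, probSafe, hf]
    rw [lintegral_indicator_const hm]
    have h2 : ENNReal.ofReal (1 - ε) ≤
        S.law none g N {h : History M 𝒴 N | S.mixtureLR h ≤ Real.exp (-τ)} := by
      have h3 := prob_compl_eq_one_sub (μ := S.law none g N) hm.compl
      rw [compl_compl] at h3
      rw [h3, ENNReal.ofReal_sub _ hε, ENNReal.ofReal_one]
      refine tsub_le_tsub_left ?_ _
      rw [show {h : History M 𝒴 N | S.mixtureLR h ≤ Real.exp (-τ)}ᶜ =
        {h | Real.exp (-τ) < S.mixtureLR h} by
          ext h
          simp only [Set.mem_compl_iff, Set.mem_ofPred_eq, not_le]]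
      exact hA
    calc ENNReal.ofReal (1 - ε') = ENNReal.ofReal ((1 - ε') / (1 - ε) * (1 - ε)) := by
          rw [div_mul_cancel₀ _ (by linarith)]
      _ = (α : ℝ≥0∞) * ENNReal.ofReal (1 - ε) := by
          rw [← hαv, ENNReal.ofReal_mul (NNReal.coe_nonneg α), ENNReal.ofReal_coe_nnreal]
      _ ≤ _ := by gcongr
  have hphi : S.phiStar N ε' ≤ S.phi f g := sInf_le ⟨f, g, hψ, rfl⟩
  refine hphi.trans ?_
  rw [S.phi_eq_lintegral hsq hρ, ← hαv, ENNReal.ofReal_mul (NNReal.coe_nonneg α),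
    ENNReal.ofReal_coe_nnreal]
  calc ∫⁻ h, f.rule h {true} * ENNReal.ofReal (S.mixtureLR h) ∂S.law none g N
      ≤ ∫⁻ _, (α : ℝ≥0∞) * ENNReal.ofReal (Real.exp (-τ)) ∂S.law none g N := by
        refine lintegral_mono fun h => ?_
        simp only [hf]
        by_cases hh : S.mixtureLR h ≤ Real.exp (-τ)
        · simp only [Set.indicator, Set.mem_ofPred_eq, hh, if_true]
          gcongr
        · simp [Set.indicator, hh]
    _ = _ := by simp

end Test

/-! ### The balancing strategy and its uniform moment bound. -/

section Balancing

/-- The strategy that selects the component with the least shifted log-likelihood ratio. -/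
noncomputable def argminSelection (hM : 0 < M) (w : Fin M → ℝ) : Selection M 𝒴 where
  rule _ := Kernel.deterministic (fun h => argminIndex hM fun j => S.totalLLR j h + w j) <|
    (measurable_argminIndex hM).comp <| measurable_pi_lambda _ fun j =>
      (S.measurable_totalLLR j).add_const _
  isMarkov _ := inferInstance

variable {S}

theorem measurable_gapPotential (c : ℝ) : Measurable (gapPotential (M := M) c) := by
  unfold gapPotential
  fun_prop

/-- The negative side is free: exp(-λ) has null expectation ∫ p₁ = 1. Convexity fills the interval
from -1 to the positive exponent given by `hmgf`. -/
theorem zero_mem_interior_integrableExpSet_llr (hsq : S.SquareIntegrable) (hmgf : S.HasFiniteMGF)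
    (u : Fin M) : (0 : ℝ) ∈ interior (integrableExpSet (S.llr u u) (S.obsMeasure 0 u)) := by
  obtain ⟨t, ht, hint⟩ := hmgf u
  have h1 : (-1 : ℝ) ∈ integrableExpSet (S.llr u u) (S.obsMeasure 0 u) := by
    refine ⟨((S.measurable_llr u u).const_mul _).exp.aestronglyMeasurable, ?_⟩
    rw [hasFiniteIntegral_iff_ofReal (Filter.Eventually.of_forall fun y => (Real.exp_pos _).le)]
    have := S.lintegral_obsKernel_some hsq u u (measurable_const (a := (1 : ℝ≥0∞)))
    simp only [one_mul, lintegral_one, measure_univ] at this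
    simp only [neg_one_mul]
    exact this.symm.trans_lt ENNReal.one_lt_top
  refine mem_interior.mpr ⟨Set.Ioo (-1) t, ?_, isOpen_Ioo, by simp [ht]⟩
  exact Set.Ioo_subset_Icc_self.trans
    ((convex_integrableExpSet (X := S.llr u u) (μ := S.obsMeasure 0 u)).ordConnected.out h1 hint)

/-- Under the balancing strategy in a homogeneous system, the exponential potential of the gaps is
bounded in expectation, uniformly in time. -/
theorem Homogeneous.exists_lintegral_gapPotential_le (hhom : S.Homogeneous) (hM : 0 < M)
    (hsq : S.SquareIntegrable) (hdiv : ∀ u, 0 < S.div u u) (hmgf : S.HasFiniteMGF)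
    (w : Fin M → ℝ) :
    ∃ c > 0, ∃ K : ℝ, 1 ≤ K ∧ ∀ n : ℕ,
      ∫⁻ h, ENNReal.ofReal (gapPotential c fun j => S.totalLLR j h + w j)
        ∂S.law none (S.argminSelection hM w) n ≤ ENNReal.ofReal K := by
  set v : Fin M := ⟨0, hM⟩ with hv
  set μ := S.obsMeasure 0 v with hμ
  obtain ⟨c, hc, ha1, hai, hbi, hab⟩ := exists_mgf_drift
    (zero_mem_interior_integrableExpSet_llr hsq hmgf v) (hdiv v) hM
  obtain ⟨r, B, hr0, hr1, hB, hdrift⟩ := exists_gapPotential_drift hM hc ha1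
    (mgf_nonneg (X := S.llr v v) (μ := μ)) hab
  set Φ₀ := gapPotential c w with hΦ₀
  have hΦ : ∀ x : Fin M → ℝ, 0 ≤ gapPotential c x := fun x =>
    Finset.sum_nonneg fun _ _ => (Real.exp_pos _).le
  have hr : 0 < 1 - r := by linarith
  have hK : r * (Φ₀ + B / (1 - r) + 1) + B ≤ Φ₀ + B / (1 - r) + 1 := by
    have h1 : (1 - r) * (B / (1 - r)) = B := mul_div_cancel₀ _ hr.ne'
    nlinarith [hΦ w]
  have hK0 : 0 ≤ B / (1 - r) := by positivity
  -- B/(1-r) is the fixed point of x ↦ rx + B, and Φ₀ covers the start at n = 0. The extra 1 gives K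
  -- ≥ 1, so that log K ≥ 0 later.
  refine ⟨c, hc, Φ₀ + B / (1 - r) + 1, by linarith [hΦ w], fun n => ?_⟩
  induction n with
  | zero =>
    simp only [law, totalLLR, Finset.univ_eq_empty, Finset.sum_empty, zero_add]
    rw [lintegral_const, measure_univ, mul_one]
    exact ENNReal.ofReal_le_ofReal (by linarith)
  | succ n ih =>
    have hmeas : ∀ {k : ℕ}, Measurable fun h : History M 𝒴 k =>
        ENNReal.ofReal (gapPotential c fun j => S.totalLLR j h + w j) := fun {_} =>
      ((measurable_gapPotential c).comp (measurable_pi_lambda _ fun j =>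
        (S.measurable_totalLLR j).add_const _)).ennreal_ofReal
    have hstep : ∀ (x : Fin M → ℝ) (i : Fin M), (∀ j, x i ≤ x j) →
        ∫⁻ y, ENNReal.ofReal (gapPotential c fun j => x j + if i = j then S.llr v v y else 0) ∂μ ≤
          ENNReal.ofReal r * ENNReal.ofReal (gapPotential c x) + ENNReal.ofReal B := by
      intro x i hi
      simp only [gapPotential_add_single hM]
      have hint1 := (show Integrable (fun y => Real.exp (c / M * S.llr v v y)) μ from hai).mul_const
        (∑ j ∈ Finset.univ.erase i, Real.exp (c * ((∑ k, x k) / M - x j)))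
      have hint2 := (show Integrable (fun y => Real.exp (-(c * ((M - 1) / M)) * S.llr v v y)) μ
        from hbi).mul_const (Real.exp (c * ((∑ k, x k) / M - x i)))
      rw [← ofReal_integral_eq_lintegral_ofReal (hint1.fun_add hint2)
        (Filter.Eventually.of_forall fun y => by simp only [Pi.zero_apply]; positivity),
        integral_add hint1 hint2, integral_mul_const, integral_mul_const,
        ← ENNReal.ofReal_mul hr0, ← ENNReal.ofReal_add (mul_nonneg hr0 (hΦ x)) hB]
      exact ENNReal.ofReal_le_ofReal (hdrift x i hi)
    rw [S.lintegral_law_succ _ _ _ hmeas]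
    calc _ ≤ ∫⁻ h, (ENNReal.ofReal r * ENNReal.ofReal (gapPotential c fun j =>
            S.totalLLR j h + w j) + ENNReal.ofReal B) ∂S.law none (S.argminSelection hM w) n := by
          refine lintegral_mono fun h => ?_
          simp only [argminSelection, Kernel.lintegral_deterministic]
          set i := argminIndex hM fun j => S.totalLLR j h + w j with hi
          refine le_of_eq_of_le ?_ (hstep (fun j => S.totalLLR j h + w j) i
            (argminIndex_le hM fun j => S.totalLLR j h + w j))
          change ∫⁻ y, _ ∂S.obsMeasure 0 i = _
          rw [hhom.obsMeasure_eq 0 i v]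
          refine lintegral_congr fun y => ?_
          congr 2
          funext j
          rw [totalLLR_snoc]
          split_ifs with hij
          · rw [← hij, hhom.llr_eq i v]
            ring
          · rw [S.llr_of_ne hij]
            ring
      _ = ENNReal.ofReal r * (∫⁻ h, ENNReal.ofReal (gapPotential c fun j =>
            S.totalLLR j h + w j) ∂S.law none (S.argminSelection hM w) n) + ENNReal.ofReal B := by
          rw [lintegral_add_right _ measurable_const, lintegral_const_mul _ hmeas]
          simp
      _ ≤ ENNReal.ofReal r * ENNReal.ofReal (Φ₀ + B / (1 - r) + 1) + ENNReal.ofReal B := by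
          gcongr
      _ ≤ _ := by
          rw [← ENNReal.ofReal_mul hr0, ← ENNReal.ofReal_add (by have := hΦ w; positivity) hB]
          exact ENNReal.ofReal_le_ofReal hK

end Balancing

/-! ### Achievability bound. -/

section Achievability

/-- If all gaps are less than `s`, the mixture likelihood ratio is at most that of the average. -/
theorem mixtureLR_le_of_gapPotential_lt (hM : 0 < M) (hρ : ∀ j, 0 < S.priorAnom j)
    {β : Fin M → ℝ} (hβ : ∀ j, β j = 1 / M) {c s : ℝ} (hc : 0 < c) {n : ℕ}
    (h : History M 𝒴 n)
    (hgap : gapPotential c (fun j => S.totalLLR j h + -Real.log (S.priorAnom j)) <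
      Real.exp (c * s)) :
    S.mixtureLR h ≤ Real.exp (s - (S.avgLLR β h + finKL β S.priorAnom)) := by
  have hM' : (0 : ℝ) < M := by positivity
  set V : Fin M → ℝ := fun j => S.totalLLR j h + -Real.log (S.priorAnom j) with hV
  -- The log M from the divergence of the uniform weights absorbs the number of terms in the
  -- mixture.
  have hW : S.avgLLR β h + finKL β S.priorAnom = (∑ j, V j) / M - Real.log M := by
    simp only [avgLLR, finKL, hβ, hV, Finset.sum_add_distrib, ← Finset.mul_sum]
    have : ∀ j, Real.log (1 / M / S.priorAnom j) = -Real.log M + -Real.log (S.priorAnom j) := by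
      intro j
      rw [Real.log_div (by positivity) (hρ j).ne', one_div, Real.log_inv]
      ring
    simp only [this, Finset.sum_add_distrib, Finset.sum_const, Finset.card_univ, Fintype.card_fin,
      nsmul_eq_mul]
    field_simp
    ring
  have hterm : ∀ j, S.priorAnom j * Real.exp (-S.totalLLR j h) ≤
      Real.exp (s - (∑ k, V k) / M) := by
    intro j
    have h1 : Real.exp (c * ((∑ i, V i) / M - V j)) < Real.exp (c * s) :=
      (Finset.single_le_sum (f := fun j => Real.exp (c * ((∑ i, V i) / M - V j)))
        (fun _ _ => (Real.exp_pos _).le) (Finset.mem_univ j)).trans_lt hgap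
    have h2 := lt_of_mul_lt_mul_left (Real.exp_lt_exp.mp h1) hc.le
    have h3 : S.priorAnom j * Real.exp (-S.totalLLR j h) = Real.exp (-V j) := by
      rw [hV, neg_add, neg_neg, Real.exp_add, Real.exp_log (hρ j)]
      ring
    rw [h3]
    exact Real.exp_le_exp.mpr (by linarith)
  calc S.mixtureLR h ≤ ∑ _j : Fin M, Real.exp (s - (∑ k, V k) / M) :=
        Finset.sum_le_sum fun j _ => hterm j
    _ = M * Real.exp (s - (∑ k, V k) / M) := by simp
    _ = _ := by
        rw [hW, show s - ((∑ j, V j) / M - Real.log M) = Real.log M + (s - (∑ k, V k) / M) by ring,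
          Real.exp_add, Real.exp_log hM']

variable {S}

/-- The threshold is calibrated at level `ε` and the test then thinned to level `ε'`. Allowing the
two to differ serves the regime where `ε'` is close to 1. -/
theorem Homogeneous.exists_phiStar_le (hhom : S.Homogeneous) (hM : 0 < M)
    (hsq : S.SquareIntegrable) (hρ : ∀ j, 0 < S.priorAnom j) (hdiv : ∀ u, 0 < S.div u u)
    (hmgf : S.HasFiniteMGF) {β : Fin M → ℝ} (hβ : ∀ j, β j = 1 / M) :
    ∃ c > 0, ∃ K : ℝ, 1 ≤ K ∧ ∀ (N : ℕ) (ε ε' δ s : ℝ) (g : Selection M 𝒴),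
      0 < δ → δ < ε → ε < 1 → ε ≤ ε' → ε' < 1 → K * Real.exp (-(c * s)) ≤ δ →
        S.phiStar N ε' ≤
          ENNReal.ofReal ((1 - ε') / (1 - ε) * Real.exp (-(S.inv β g N (ε - δ) - s))) := by
  obtain ⟨c, hc, K, hK, hbound⟩ := hhom.exists_lintegral_gapPotential_le hM hsq hdiv hmgf
    fun j => -Real.log (S.priorAnom j)
  refine ⟨c, hc, K, hK, fun N ε ε' δ s g hδ hδε hε1 hle hε' hs => ?_⟩
  set w : Fin M → ℝ := fun j => -Real.log (S.priorAnom j) with hw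
  set g₀ : Selection M 𝒴 := S.argminSelection hM w with hg₀
  refine S.phiStar_le_of_measure_le hsq hρ g₀ hε1 hle hε' ?_ (by linarith)
  set q := S.inv β g N (ε - δ) with hq
  have hWm : Measurable fun h : History M 𝒴 N => S.avgLLR β h + finKL β S.priorAnom :=
    (S.measurable_avgLLR β).add_const _
  have hΦm : Measurable fun h : History M 𝒴 N =>
      ENNReal.ofReal (gapPotential c fun j => S.totalLLR j h + w j) :=
    ((measurable_gapPotential c).comp (measurable_pi_lambda _ fun j =>
      (S.measurable_totalLLR j).add_const _)).ennreal_ofReal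
  have hsub : {h : History M 𝒴 N | Real.exp (-(q - s)) < S.mixtureLR h} ⊆
      ((fun h : History M 𝒴 N => S.avgLLR β h + finKL β S.priorAnom) ⁻¹' Set.Iio q) ∪
      {h | ENNReal.ofReal (Real.exp (c * s)) ≤
        ENNReal.ofReal (gapPotential c fun j => S.totalLLR j h + w j)} := by
    intro h hh
    by_contra hcon
    simp only [Set.mem_union, Set.mem_preimage, Set.mem_Iio, Set.mem_ofPred_eq, not_or, not_lt,
      not_le] at hcon hh
    have h1 := S.mixtureLR_le_of_gapPotential_lt hM hρ hβ hc h
      (ENNReal.ofReal_lt_ofReal_iff (Real.exp_pos _) |>.mp hcon.2)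
    have h2 := Real.exp_lt_exp.mp (hh.trans_le h1)
    linarith [hcon.1]
  -- The quantile is defined through `g` but the test uses `g₀`; both give W the same law.
  have hfirst : S.law none g₀ N
      ((fun h : History M 𝒴 N => S.avgLLR β h + finKL β S.priorAnom) ⁻¹' Set.Iio q) ≤
      ENNReal.ofReal (ε - δ) := by
    have := Measure.isProbabilityMeasure_map (μ := S.law none g N) hWm.aemeasurable
    have h1 := measureReal_Iio_quantile_le ((S.law none g N).map fun h =>
      S.avgLLR β h + finKL β S.priorAnom) (t := ε - δ) (by linarith)
    rw [← Measure.map_apply hWm measurableSet_Iio, hhom.map_avgLLR_eq hβ g₀ g,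
      ← ofReal_measureReal]
    exact ENNReal.ofReal_le_ofReal h1
  -- Markov's inequality for the potential.
  have hsecond : S.law none g₀ N {h | ENNReal.ofReal (Real.exp (c * s)) ≤
        ENNReal.ofReal (gapPotential c fun j => S.totalLLR j h + w j)} ≤ ENNReal.ofReal δ := by
    refine (meas_ge_le_lintegral_div hΦm.aemeasurable
      (by simpa using Real.exp_pos _) ENNReal.ofReal_ne_top).trans ?_
    refine (ENNReal.div_le_div_right (hbound N) _).trans ?_
    rw [← ENNReal.ofReal_div_of_pos (Real.exp_pos _)]
    refine ENNReal.ofReal_le_ofReal ?_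
    rwa [div_eq_mul_inv, ← Real.exp_neg]
  calc _ ≤ _ := measure_mono hsub
    _ ≤ _ := measure_union_le _ _
    _ ≤ ENNReal.ofReal (ε - δ) + ENNReal.ofReal δ := add_le_add hfirst hsecond
    _ = ENNReal.ofReal ε := by
        rw [← ENNReal.ofReal_add (by linarith) hδ.le, sub_add_cancel]

end Achievability

end System

/-! ### Passage to logarithms and the main theorem. -/

theorem le_neg_log_of_le_ofReal_exp {a : ℝ≥0∞} {x : ℝ} (h : a ≤ ENNReal.ofReal (Real.exp (-x))) :
    (x : EReal) ≤ -ENNReal.log a := by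
  refine EReal.le_neg_of_le_neg ((ENNReal.log_le_log h).trans ?_)
  rw [ENNReal.log_ofReal_of_pos (Real.exp_pos _), Real.log_exp]
  simp

theorem neg_log_le_of_ofReal_exp_le {a : ℝ≥0∞} {x : ℝ} (h : ENNReal.ofReal (Real.exp (-x)) ≤ a) :
    -ENNReal.log a ≤ (x : EReal) := by
  refine EReal.neg_le_of_neg_le (le_trans ?_ (ENNReal.log_le_log h))
  rw [ENNReal.log_ofReal_of_pos (Real.exp_pos _), Real.log_exp]
  simp

end ActiveVerification

theorem mainTheorem1 {M : ℕ} (hM : 0 < M) {𝒴 : Type*} [MeasurableSpace 𝒴]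
    (S : ActiveVerification.System M 𝒴)
    (hhom : S.Homogeneous)
    (hprior : ∀ j, 0 < S.prior (some j))
    (hsq : S.SquareIntegrable)
    (hdiv : ∀ u, 0 < S.div u u)
    (β : Fin M → ℝ) (hβ : S.IsMinimaxDist β) :
    (∀ (N : ℕ) (ε η : ℝ) (g : ActiveVerification.Selection M 𝒴),
      0 < ε → ε < 1 → 1 < η → ε + ε / η < 1 →
        -ENNReal.log (S.phiStar N ε) ≤
          ((S.inv β g N (ε + ε / η) + Real.log (η / ε) : ℝ) : EReal)) ∧
    (S.HasFiniteMGF →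
      ∃ C : ℝ, 0 < C ∧
        ∀ (N : ℕ) (ε η : ℝ) (g : ActiveVerification.Selection M 𝒴),
          0 < ε → ε < 1 → 1 < η →
            ((S.inv β g N (ε - ε / η) - C * Real.log (η / ε) : ℝ) : EReal) ≤
              -ENNReal.log (S.phiStar N ε)) := by
  have hM' : (0 : ℝ) < M := by positivity
  have hu : ∀ u, β u = 1 / M := hhom.minimaxDist_eq hM hdiv hβ
  have hρ := S.priorAnom_pos hM hprior
  have hWm : ∀ N, Measurable fun h : ActiveVerification.History M 𝒴 N =>
      S.avgLLR β h + ActiveVerification.finKL β S.priorAnom := fun N =>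
    (S.measurable_avgLLR β).add_const _
  have hprob : ∀ (N : ℕ) (g : ActiveVerification.Selection M 𝒴),
      IsProbabilityMeasure ((S.law none g N).map fun h =>
        S.avgLLR β h + ActiveVerification.finKL β S.priorAnom) := fun N g =>
    Measure.isProbabilityMeasure_map (hWm N).aemeasurable
  constructor
  · intro N ε η g hε hε1 hη hsum
    have hδ : 0 < ε / η := by positivity
    have := hprob N g
    refine ActiveVerification.neg_log_le_of_ofReal_exp_le ?_
    have h1 := S.le_phiStar (N := N) (ε := ε) (δ := ε / η) (a := S.inv β g N (ε + ε / η)) hsq hρ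
      (fun j => by rw [hu j]; positivity) hβ.1.2 hsum fun g' => by
        rw [hhom.map_avgLLR_eq hu g' g]
        exact ActiveVerification.le_measureReal_Iic_quantile _ hsum
    refine le_of_eq_of_le ?_ h1
    rw [neg_add, Real.exp_add, ← Real.log_inv, inv_div, Real.exp_log hδ]
  · intro hmgf
    obtain ⟨c, hc, K, hK, hach⟩ := hhom.exists_phiStar_le hM hsq hρ hdiv hmgf hu
    have hlogK : 0 ≤ Real.log K := Real.log_nonneg hK
    have hK0 : 0 < K := by linarith
    -- This `s` solves K exp(-cs) = δ.
    have hs : ∀ δ : ℝ, 0 < δ →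
        K * Real.exp (-(c * ((Real.log K + Real.log δ⁻¹) / c))) ≤ δ := fun δ hδ => by
      rw [mul_div_cancel₀ _ hc.ne', neg_add, Real.exp_add, Real.log_inv, neg_neg, Real.exp_log hδ,
        Real.exp_neg, Real.exp_log hK0, ← mul_assoc, mul_inv_cancel₀ hK0.ne', one_mul]
    set s₀ : ℝ := (Real.log K + Real.log ((1 / 4 : ℝ)⁻¹)) / c with hs₀
    -- The loss (log K + L)/c, with L = log(η/ε), is at most C·L only if L is bounded below. `c₀`
    -- separates that regime from small L, where ε and η are both near 1.
    set c₀ : ℝ := min (Real.exp (-s₀) / 2) (1 / 4) with hc₀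
    have hc₀pos : 0 < c₀ := lt_min (by positivity) (by norm_num)
    refine ⟨(Real.log K / c₀ + 1) / c, by positivity, fun N ε η g hε hε1 hη => ?_⟩
    have hδ : 0 < ε / η := by positivity
    have hδε : ε / η < ε := div_lt_self hε hη
    have hinv : η / ε = (ε / η)⁻¹ := (inv_div _ _).symm
    rw [hinv]
    set δ := ε / η with hδdef
    set L := Real.log δ⁻¹ with hL
    have h1δ : 1 - δ ≤ L := by
      have := Real.one_sub_inv_le_log_of_pos (inv_pos.mpr hδ)
      rwa [inv_inv] at this
    apply ActiveVerification.le_neg_log_of_le_ofReal_exp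
    rcases le_or_gt c₀ L with hcase | hcase
    · refine (hach N ε ε δ _ g hδ hδε hε1 le_rfl hε1 (hs δ hδ)).trans ?_
      refine ENNReal.ofReal_le_ofReal ?_
      rw [div_self (by linarith), one_mul]
      refine Real.exp_le_exp.mpr (neg_le_neg (sub_le_sub_left ?_ _))
      rw [div_mul_eq_mul_div]
      refine div_le_div_of_nonneg_right ?_ hc.le
      rw [add_mul, one_mul, div_mul_eq_mul_div, add_le_add_iff_right, le_div_iff₀ hc₀pos]
      exact mul_le_mul_of_nonneg_left hcase hlogK
    -- Here 1 - ε < 1 - δ ≤ L < 1/4, so ε > 1/2 and ε - δ < 1/4. The test of level 1/2 with slack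
    -- 1/4, thinned by 2(1 - ε) ≤ exp(-s₀), cancels its loss `s₀` entirely.
    · have hL1 : L < Real.exp (-s₀) / 2 := hcase.trans_le (min_le_left _ _)
      have hL2 : L < 1 / 4 := hcase.trans_le (min_le_right _ _)
      have hL0 : 0 ≤ L := by linarith
      refine (hach N (1 / 2) ε (1 / 4) s₀ g (by norm_num) (by norm_num) (by norm_num)
        (by linarith) hε1 (hs _ (by norm_num))).trans ?_
      refine ENNReal.ofReal_le_ofReal ?_
      have hq : S.inv β g N (ε - δ) ≤ S.inv β g N (1 / 2 - 1 / 4) := by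
        have := hprob N g
        exact ActiveVerification.quantile_mono _ (by linarith) (by linarith) (by norm_num)
      have hα : (1 - ε) / (1 - 1 / 2) ≤ Real.exp (-s₀) := by
        rw [div_le_iff₀ (by norm_num)]
        linarith
      calc _ ≤ Real.exp (-s₀) * Real.exp (-(S.inv β g N (1 / 2 - 1 / 4) - s₀)) := by gcongr
        _ = Real.exp (-S.inv β g N (1 / 2 - 1 / 4)) := by
            rw [← Real.exp_add]
            congr 1
            ring
        _ ≤ _ := by
            refine Real.exp_le_exp.mpr (neg_le_neg ?_)
            have : 0 ≤ (Real.log K / c₀ + 1) / c * L := by positivity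
            linarith
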